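/- A tournament is a complete directed graph (exactly one directed edge between any two distinct nodes, no loops). A real skew-symmetric matrix $M\in\mathbb R^{n\times n}$ with $M_{ij}\neq 0$ for all $i\ne j$ induces a tournament on $\{1,\dots,n\}$ by putting an edge $i\to j$ if and only if $M_{ij}>0$; the *rank-$4$ tournament class* consists of all tournaments (on any number $n$ of nodes) induced in this way by such matrices of rank $4$. A tournament $R$ is *doubly regular* if all its nodes have the same out-degree and there is a $k$ such that any two distinct nodes have exactly $k$ common out-neighbours. A tournament $T$ is an *$R$-cone* if it has a node $c$ which either beats all other nodes or loses to all other nodes, such that the sub-tournament of $T$ induced on the nodes other than $c$ is isomorphic to $R$. **Theorem.** Let $R$ be a doubly regular tournament on $11$ nodes, and let $T$ be an $R$-cone (a tournament on $12$ nodes). Then $T$ is forbidden for the rank-$4$ tournament class: no tournament in the rank-$4$ tournament class has an induced sub-tournament isomorphic to $T$. -/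

import Mathlib

/-- A tournament on the node set `V`: a complete directed graph, that is, between two distinct
nodes there is exactly one directed edge, and there are no loops. -/
structure Tournament (V : Type*) where
  /-- `beats i j`: there is a directed edge from `i` to `j`. -/
  beats : V → V → Prop
  irrefl : ∀ i, ¬ beats i i
  beats_iff_not_beats : ∀ i j, i ≠ j → (beats i j ↔ ¬ beats j i)

namespace Tournament

variable {V W : Type*}

/-- The out-neighbours `T⁺ᵢ` of a node. -/
def outNbrs (T : Tournament V) (i : V) : Set V := {j | T.beats i j}

/-- The in-neighbours `T⁻ᵢ` of a node. -/
def inNbrs (T : Tournament V) (i : V) : Set V := {j | T.beats j i}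

/-- The induced sub-tournament `T(S)` on a set `S` of nodes. -/
def induce (T : Tournament V) (S : Set V) : Tournament S where
  beats i j := T.beats i j
  irrefl i := T.irrefl i
  beats_iff_not_beats i j hij :=
    T.beats_iff_not_beats i j (fun h => hij (Subtype.ext h))

/-- Two tournaments are isomorphic if some bijection of the nodes preserves the directed edges
in both directions. -/
def Isomorphic (T : Tournament V) (T' : Tournament W) : Prop :=
  Nonempty (T.beats ≃r T'.beats)

/-- All out-degrees are equal, and any two distinct nodes have the same number of common
out-neighbours (used for tournaments on finite node sets). -/
def IsDoublyRegular (T : Tournament V) : Prop :=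
  (∀ i j, (T.outNbrs i).ncard = (T.outNbrs j).ncard) ∧
    ∃ k : ℕ, ∀ i j, i ≠ j → (T.outNbrs i ∩ T.outNbrs j).ncard = k

/-- `T` is an `R`-cone: some node beats all other nodes (or loses to all other nodes), and the
other nodes induce a tournament isomorphic to `R`. -/
def IsCone (T : Tournament V) (R : Tournament W) : Prop :=
  ∃ c : V,
    ((∀ j, j ≠ c → T.beats c j) ∧ (T.induce (T.outNbrs c)).Isomorphic R) ∨
    ((∀ j, j ≠ c → T.beats j c) ∧ (T.induce (T.inNbrs c)).Isomorphic R)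

/-- The tournament `T{M}` induced by a real skew symmetric matrix whose off-diagonal entries are
all nonzero: there is an edge from `i` to `j` if and only if `M i j > 0`. -/
def ofMatrix {n : ℕ} (M : Matrix (Fin n) (Fin n) ℝ) (hskew : M.transpose = -M)
    (hne : ∀ i j, i ≠ j → M i j ≠ 0) : Tournament (Fin n) where
  beats i j := 0 < M i j
  irrefl i h := by
    have h1 : M i i = -M i i := congrFun (congrFun hskew i) i
    linarith
  beats_iff_not_beats i j hij := by
    have h1 : M j i = -M i j := congrFun (congrFun hskew i) j
    have h2 := hne i j hij
    constructor
    · intro h h'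
      linarith
    · intro h
      exact lt_of_le_of_ne (by linarith) (Ne.symm h2)

end Tournament

/-- A class of (finite) tournaments: for every `n`, a set of tournaments on `n` nodes. -/
def TournamentClass : Type := ∀ n : ℕ, Set (Tournament (Fin n))

/-- The rank `d` tournament class: all tournaments induced by real skew symmetric matrices of
rank `d` (of any size) with nonzero off-diagonal entries. -/
def rankTournamentClass (d : ℕ) : TournamentClass := fun n =>
  {T | ∃ (M : Matrix (Fin n) (Fin n) ℝ) (hskew : M.transpose = -M)
    (hne : ∀ i j, i ≠ j → M i j ≠ 0), M.rank = d ∧ T = Tournament.ofMatrix M hskew hne}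

/-- The class `𝒯` forbids `T` if no tournament in `𝒯` has a sub-tournament isomorphic to `T`. -/
def TournamentClass.Forbids {V : Type*} (𝒯 : TournamentClass) (T : Tournament V) : Prop :=
  ∀ (n : ℕ), ∀ T' ∈ 𝒯 n, ∀ S : Set (Fin n), ¬ (T'.induce S).Isomorphic T

/-! ### Linear relations from vanishing Pfaffians. -/

section Pfaffian

open Matrix

/-! Already nine nodes of the copy of `R` inside the cone are contradictory. In rank at most 4 all
`6 × 6` Pfaffians vanish, so any five rows satisfy a linear relation whose coefficients are `4 × 4`
Pfaffians (`Matrix.pf₄_relation`). In every column the five terms of this relation must cancel, so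
their signs cannot all agree.

For `nineNodes`, six Pfaffians have a sign dictated by the edges. Among the three undetermined ones
`P 0 1 2 3`, `P 0 2 3 4`, `P 0 2 3 7`, two share a weak sign, and each such coincidence is excluded
by two columns of one relation (`not_nineNodes_of_rank_le_four`).

Counting common out-neighbours determines enough of a doubly regular tournament on 11 nodes to find
`nineNodes` in it (`IsDoublyRegular.exists_numbering`, `IsDoublyRegular.exists_nineNodes`). -/

/-- The Pfaffian of the `4 × 4` skew-symmetric matrix with rows and columns `a, b, c, d` of `M`. -/
def Matrix.pf₄ {n : Type*} (M : Matrix n n ℝ) (a b c d : n) : ℝ :=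
  M a b * M c d - M a c * M b d + M a d * M b c

theorem Matrix.apply_eq_neg_of_transpose_eq_neg {n : Type*} {M : Matrix n n ℝ}
    (hM : M.transpose = -M) (i j : n) : M i j = -M j i :=
  congrFun (congrFun hM j) i

/-- The Pfaffian of a singular skew-symmetric `6 × 6` matrix vanishes. -/
theorem Matrix.pf_six_eq_zero_of_det_eq_zero {B : Matrix (Fin 6) (Fin 6) ℝ}
    (hB : B.transpose = -B) (hdet : B.det = 0) :
    B 0 5 * B.pf₄ 1 2 3 4 - B 1 5 * B.pf₄ 0 2 3 4 + B 2 5 * B.pf₄ 0 1 3 4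
      - B 3 5 * B.pf₄ 0 1 2 4 + B 4 5 * B.pf₄ 0 1 2 3 = 0 := by
  obtain ⟨v, hv, hBv⟩ := exists_mulVec_eq_zero_iff.mpr hdet
  by_contra hne
  have skew := apply_eq_neg_of_transpose_eq_neg hB
  have diag (i) : B i i = 0 := by linarith [skew i i]
  have row (i) : B i 0 * v 0 + B i 1 * v 1 + B i 2 * v 2 + B i 3 * v 3 + B i 4 * v 4
      + B i 5 * v 5 = 0 := by
    have := congrFun hBv i
    simpa [mulVec, dotProduct, Fin.sum_univ_succ, add_assoc] using this
  have r0 := row 0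
  have r1 := row 1
  have r2 := row 2
  have r3 := row 3
  have r4 := row 4
  have r5 := row 5
  simp only [diag, skew 1 0, skew 2 0, skew 3 0, skew 4 0, skew 5 0, skew 2 1, skew 3 1, skew 4 1,
    skew 5 1, skew 3 2, skew 4 2, skew 5 2, skew 4 3, skew 5 3, skew 5 4] at r0 r1 r2 r3 r4 r5
  apply hv
  funext i
  -- The Pfaffian kills each coordinate of the kernel vector: combine the rows of `B v = 0` with
  -- signed `4 × 4` Pfaffians, as with an adjugate.
  apply (mul_eq_zero.mp _).resolve_left hne
  fin_cases i <;> simp only [Fin.zero_eta, Fin.mk_one, Fin.reduceFinMk]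
  · linear_combination (norm := (simp only [pf₄]; ring))
      (-1) * (B.pf₄ 2 3 4 5 * r1 - B.pf₄ 1 3 4 5 * r2 + B.pf₄ 1 2 4 5 * r3
      - B.pf₄ 1 2 3 5 * r4 + B.pf₄ 1 2 3 4 * r5)
  · linear_combination (norm := (simp only [pf₄]; ring))
      (B.pf₄ 2 3 4 5 * r0 - B.pf₄ 0 3 4 5 * r2 + B.pf₄ 0 2 4 5 * r3
      - B.pf₄ 0 2 3 5 * r4 + B.pf₄ 0 2 3 4 * r5)
  · linear_combination (norm := (simp only [pf₄]; ring))
      (-1) * (B.pf₄ 1 3 4 5 * r0 - B.pf₄ 0 3 4 5 * r1 + B.pf₄ 0 1 4 5 * r3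
      - B.pf₄ 0 1 3 5 * r4 + B.pf₄ 0 1 3 4 * r5)
  · linear_combination (norm := (simp only [pf₄]; ring))
      (B.pf₄ 1 2 4 5 * r0 - B.pf₄ 0 2 4 5 * r1 + B.pf₄ 0 1 4 5 * r2
      - B.pf₄ 0 1 2 5 * r4 + B.pf₄ 0 1 2 4 * r5)
  · linear_combination (norm := (simp only [pf₄]; ring))
      (-1) * (B.pf₄ 1 2 3 5 * r0 - B.pf₄ 0 2 3 5 * r1 + B.pf₄ 0 1 3 5 * r2
      - B.pf₄ 0 1 2 5 * r3 + B.pf₄ 0 1 2 3 * r5)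
  · linear_combination (norm := (simp only [pf₄]; ring))
      (B.pf₄ 1 2 3 4 * r0 - B.pf₄ 0 2 3 4 * r1 + B.pf₄ 0 1 3 4 * r2
      - B.pf₄ 0 1 2 4 * r3 + B.pf₄ 0 1 2 3 * r4)

/-- The submatrix factors through `M`. Injectivity of `f` is not required, so a column may later
coincide with one of the five rows. -/
theorem Matrix.det_submatrix_eq_zero_of_rank_lt {n : Type*} [Fintype n] {M : Matrix n n ℝ} {k : ℕ}
    (hM : M.rank < k) (f : Fin k → n) : (M.submatrix f f).det = 0 := by
  classical
  by_contra h
  have hr := rank_of_isUnit (M.submatrix f f)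
    ((isUnit_iff_isUnit_det _).mpr (isUnit_iff_ne_zero.mpr h))
  have hfac : M.submatrix f f
      = (1 : Matrix n n ℝ).submatrix f id * (M * (1 : Matrix n n ℝ).submatrix id f) := by
    ext i j
    simp [mul_apply, one_apply]
  have := (rank_mul_le_right ((1 : Matrix n n ℝ).submatrix f id)
    (M * (1 : Matrix n n ℝ).submatrix id f)).trans (rank_mul_le_left M _)
  rw [← hfac, hr, Fintype.card_fin] at this
  omega

/-- The five Pfaffian minors of five rows of a skew-symmetric matrix of rank at most `4` are the
coefficients of a linear relation between these rows. -/
theorem Matrix.pf₄_relation {n : Type*} [Fintype n] {M : Matrix n n ℝ}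
    (hskew : M.transpose = -M) (hrank : M.rank ≤ 4) (a b c d e j : n) :
    M a j * M.pf₄ b c d e - M b j * M.pf₄ a c d e + M c j * M.pf₄ a b d e
      - M d j * M.pf₄ a b c e + M e j * M.pf₄ a b c d = 0 := by
  have h := pf_six_eq_zero_of_det_eq_zero (B := M.submatrix ![a, b, c, d, e, j] ![a, b, c, d, e, j])
    (by rw [transpose_submatrix, hskew, submatrix_neg]; rfl)
    (det_submatrix_eq_zero_of_rank_lt (by omega) _)
  simpa [pf₄] using h

end Pfaffian

/-! ### The sign contradiction on nine nodes. -/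

/-- A partial tournament on nine nodes which is contained in every doubly regular tournament on
eleven nodes: node `0` beats the nodes `1, …, 5`, which form a regular tournament, and loses to
`6, 7, 8`, each of which beats exactly two of `1, …, 5`. The edge between `6` and `8` is left
open. -/
def nineNodes : Fin 9 → Fin 9 → Bool :=
  ![![false, true, true, true, true, true, false, false, false],
    ![false, false, true, true, false, false, false, true, true],
    ![false, false, false, true, true, false, true, false, true],
    ![false, false, false, false, true, true, false, true, false],
    ![false, true, false, false, false, true, true, false, true],
    ![false, true, true, false, false, false, true, true, false],
    ![true, true, false, true, false, false, false, false, false],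
    ![true, false, true, false, true, false, true, false, false],
    ![true, false, false, true, false, true, false, true, false]]

open Matrix in
/-- No skew-symmetric matrix of rank at most `4` induces a tournament containing `nineNodes`. -/
theorem not_nineNodes_of_rank_le_four {n : Type*} [Fintype n] {M : Matrix n n ℝ}
    (hskew : M.transpose = -M) (hrank : M.rank ≤ 4) (f : Fin 9 → n)
    (pos : ∀ i j, nineNodes i j = true → 0 < M (f i) (f j)) : False := by
  have neg (i j) (h : nineNodes j i = true) : M (f i) (f j) < 0 := by
    rw [apply_eq_neg_of_transpose_eq_neg hskew]
    linarith [pos j i h]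
  have diag (i) : M (f i) (f i) = 0 := by
    linarith [apply_eq_neg_of_transpose_eq_neg hskew (f i) (f i)]
  let P (a b c d : Fin 9) : ℝ := M.pf₄ (f a) (f b) (f c) (f d)
  have rel (a b c d e j : Fin 9) : M (f a) (f j) * P b c d e - M (f b) (f j) * P a c d e
      + M (f c) (f j) * P a b d e - M (f d) (f j) * P a b c e + M (f e) (f j) * P a b c d = 0 :=
    pf₄_relation hskew hrank _ _ _ _ _ _
  -- In each of these six Pfaffians the three signed products have the same sign.
  have u0124 : 0 < P 0 1 2 4 := by
    simp only [P, pf₄]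
    linarith [mul_pos (pos 0 1 rfl) (pos 2 4 rfl),
      mul_neg_of_pos_of_neg (pos 0 2 rfl) (neg 1 4 rfl),
      mul_pos (pos 0 4 rfl) (pos 1 2 rfl)]
  have u0127 : P 0 1 2 7 < 0 := by
    simp only [P, pf₄]
    linarith [mul_neg_of_pos_of_neg (pos 0 1 rfl) (neg 2 7 rfl),
      mul_pos (pos 0 2 rfl) (pos 1 7 rfl),
      mul_neg_of_neg_of_pos (neg 0 7 rfl) (pos 1 2 rfl)]
  have u0134 : 0 < P 0 1 3 4 := by
    simp only [P, pf₄]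
    linarith [mul_pos (pos 0 1 rfl) (pos 3 4 rfl),
      mul_neg_of_pos_of_neg (pos 0 3 rfl) (neg 1 4 rfl),
      mul_pos (pos 0 4 rfl) (pos 1 3 rfl)]
  have u0347 : P 0 3 4 7 < 0 := by
    simp only [P, pf₄]
    linarith [mul_neg_of_pos_of_neg (pos 0 3 rfl) (neg 4 7 rfl),
      mul_pos (pos 0 4 rfl) (pos 3 7 rfl),
      mul_neg_of_neg_of_pos (neg 0 7 rfl) (pos 3 4 rfl)]
  have u1237 : 0 < P 1 2 3 7 := by
    simp only [P, pf₄]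
    linarith [mul_pos (pos 1 2 rfl) (pos 3 7 rfl),
      mul_neg_of_pos_of_neg (pos 1 3 rfl) (neg 2 7 rfl),
      mul_pos (pos 1 7 rfl) (pos 2 3 rfl)]
  have u2347 : P 2 3 4 7 < 0 := by
    simp only [P, pf₄]
    linarith [mul_neg_of_pos_of_neg (pos 2 3 rfl) (neg 4 7 rfl),
      mul_pos (pos 2 4 rfl) (pos 3 7 rfl),
      mul_neg_of_neg_of_pos (neg 2 7 rfl) (pos 3 4 rfl)]
  -- Each exclusion uses one five-row relation: a first column forces the sign of its one remaining
  -- Pfaffian (`key`), then a second column has all terms of one sign.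
  have not_nonneg_0123_0234 (h0123 : 0 ≤ P 0 1 2 3) (h0234 : 0 ≤ P 0 2 3 4) : False := by
    have key : 0 < P 1 2 3 4 := by
      by_contra! h
      linarith [rel 0 1 2 3 4 6,
        mul_nonneg_of_nonpos_of_nonpos (neg 0 6 rfl).le h,
        mul_nonpos_of_nonpos_of_nonneg (neg 1 6 rfl).le h0234,
        mul_pos (pos 2 6 rfl) u0134,
        mul_neg_of_neg_of_pos (neg 3 6 rfl) u0124,
        mul_nonneg (pos 4 6 rfl).le h0123]
    linarith [rel 0 1 2 3 4 7,
      mul_neg_of_neg_of_pos (neg 0 7 rfl) key,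
      mul_nonneg (pos 1 7 rfl).le h0234,
      mul_neg_of_neg_of_pos (neg 2 7 rfl) u0134,
      mul_pos (pos 3 7 rfl) u0124,
      mul_nonpos_of_nonpos_of_nonneg (neg 4 7 rfl).le h0123]
  have not_nonneg_0123_0237 (h0123 : 0 ≤ P 0 1 2 3) (h0237 : 0 ≤ P 0 2 3 7) : False := by
    have key : P 0 1 3 7 < 0 := by
      by_contra! h
      linarith [rel 0 1 2 3 7 4,
        mul_pos (pos 0 4 rfl) u1237,
        mul_nonpos_of_nonpos_of_nonneg (neg 1 4 rfl).le h0237,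
        mul_nonneg (pos 2 4 rfl).le h,
        mul_neg_of_pos_of_neg (pos 3 4 rfl) u0127,
        mul_nonneg (pos 7 4 rfl).le h0123]
    linarith [rel 0 1 2 3 7 8,
      mul_neg_of_neg_of_pos (neg 0 8 rfl) u1237,
      mul_nonneg (pos 1 8 rfl).le h0237,
      mul_neg_of_pos_of_neg (pos 2 8 rfl) key,
      mul_pos_of_neg_of_neg (neg 3 8 rfl) u0127,
      mul_nonpos_of_nonpos_of_nonneg (neg 7 8 rfl).le h0123]
  have not_nonpos_0234_0237 (h0234 : P 0 2 3 4 ≤ 0) (h0237 : P 0 2 3 7 ≤ 0) : False := by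
    have key : P 0 2 4 7 < 0 := by
      by_contra! h
      linarith [rel 0 2 3 4 7 0,
        mul_eq_zero_of_left (diag 0) (P 2 3 4 7),
        mul_pos_of_neg_of_neg (neg 2 0 rfl) u0347,
        mul_nonpos_of_nonpos_of_nonneg (neg 3 0 rfl).le h,
        mul_nonneg_of_nonpos_of_nonpos (neg 4 0 rfl).le h0237,
        mul_nonpos_of_nonneg_of_nonpos (pos 7 0 rfl).le h0234]
    linarith [rel 0 2 3 4 7 8,
      mul_pos_of_neg_of_neg (neg 0 8 rfl) u2347,
      mul_neg_of_pos_of_neg (pos 2 8 rfl) u0347,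
      mul_pos_of_neg_of_neg (neg 3 8 rfl) key,
      mul_nonpos_of_nonneg_of_nonpos (pos 4 8 rfl).le h0237,
      mul_nonneg_of_nonpos_of_nonpos (neg 7 8 rfl).le h0234]
  have not_nonneg_0234_0237 (h0234 : 0 ≤ P 0 2 3 4) (h0237 : 0 ≤ P 0 2 3 7) : False := by
    have key : P 0 2 4 7 < 0 := by
      by_contra! h
      linarith [rel 0 2 3 4 7 1,
        mul_neg_of_pos_of_neg (pos 0 1 rfl) u2347,
        mul_pos_of_neg_of_neg (neg 2 1 rfl) u0347,
        mul_nonpos_of_nonpos_of_nonneg (neg 3 1 rfl).le h,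
        mul_nonneg (pos 4 1 rfl).le h0237,
        mul_nonpos_of_nonpos_of_nonneg (neg 7 1 rfl).le h0234]
    linarith [rel 0 2 3 4 7 5,
      mul_neg_of_pos_of_neg (pos 0 5 rfl) u2347,
      mul_pos_of_neg_of_neg (neg 2 5 rfl) u0347,
      mul_neg_of_pos_of_neg (pos 3 5 rfl) key,
      mul_nonneg (pos 4 5 rfl).le h0237,
      mul_nonpos_of_nonpos_of_nonneg (neg 7 5 rfl).le h0234]
  have not_nonpos_0123_0237 (h0123 : P 0 1 2 3 ≤ 0) (h0237 : P 0 2 3 7 ≤ 0) : False := by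
    have key : P 0 1 3 7 < 0 := by
      by_contra! h
      linarith [rel 0 1 2 3 7 0,
        mul_eq_zero_of_left (diag 0) (P 1 2 3 7),
        mul_nonneg_of_nonpos_of_nonpos (neg 1 0 rfl).le h0237,
        mul_nonpos_of_nonpos_of_nonneg (neg 2 0 rfl).le h,
        mul_pos_of_neg_of_neg (neg 3 0 rfl) u0127,
        mul_nonpos_of_nonneg_of_nonpos (pos 7 0 rfl).le h0123]
    linarith [rel 0 1 2 3 7 6,
      mul_neg_of_neg_of_pos (neg 0 6 rfl) u1237,
      mul_nonneg_of_nonpos_of_nonpos (neg 1 6 rfl).le h0237,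
      mul_neg_of_pos_of_neg (pos 2 6 rfl) key,
      mul_pos_of_neg_of_neg (neg 3 6 rfl) u0127,
      mul_nonpos_of_nonneg_of_nonpos (pos 7 6 rfl).le h0123]
  have not_nonpos_0123_0234 (h0123 : P 0 1 2 3 ≤ 0) (h0234 : P 0 2 3 4 ≤ 0) : False := by
    have key : P 1 2 3 4 < 0 := by
      by_contra! h
      linarith [rel 0 1 2 3 4 2,
        mul_eq_zero_of_left (diag 2) (P 0 1 3 4),
        mul_nonneg (pos 0 2 rfl).le h,
        mul_nonpos_of_nonneg_of_nonpos (pos 1 2 rfl).le h0234,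
        mul_neg_of_neg_of_pos (neg 3 2 rfl) u0124,
        mul_nonneg_of_nonpos_of_nonpos (neg 4 2 rfl).le h0123]
    linarith [rel 0 1 2 3 4 5,
      mul_neg_of_pos_of_neg (pos 0 5 rfl) key,
      mul_nonneg_of_nonpos_of_nonpos (neg 1 5 rfl).le h0234,
      mul_neg_of_neg_of_pos (neg 2 5 rfl) u0134,
      mul_pos (pos 3 5 rfl) u0124,
      mul_nonpos_of_nonneg_of_nonpos (pos 4 5 rfl).le h0123]
  rcases le_total 0 (P 0 1 2 3) with hx | hx <;> rcases le_total 0 (P 0 2 3 4) with hy | hy <;>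
    rcases le_total 0 (P 0 2 3 7) with hz | hz
  all_goals first
    | exact not_nonneg_0123_0234 hx hy
    | exact not_nonneg_0123_0237 hx hz
    | exact not_nonneg_0234_0237 hy hz
    | exact not_nonpos_0123_0234 hx hy
    | exact not_nonpos_0123_0237 hx hz
    | exact not_nonpos_0234_0237 hy hz

/-! ### Degree counting and regular tournaments on five nodes. -/

namespace Tournament

open Finset

variable {V : Type*} (T : Tournament V)

open Classical in
/-- The entries of the adjacency matrix of a tournament. -/
noncomputable def adj (i j : V) : ℕ := if T.beats i j then 1 else 0

theorem adj_eq_one_iff {i j : V} : T.adj i j = 1 ↔ T.beats i j := by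
  simp [adj]

theorem adj_le_one (i j : V) : T.adj i j ≤ 1 := by
  unfold adj
  split_ifs <;> simp

theorem adj_self (i : V) : T.adj i i = 0 := by
  simp [adj, T.irrefl i]

theorem adj_add_adj_swap {i j : V} (h : i ≠ j) : T.adj i j + T.adj j i = 1 := by
  have := T.beats_iff_not_beats i j h
  unfold adj
  by_cases hij : T.beats i j <;> by_cases hji : T.beats j i <;> simp_all

theorem adj_swap_eq_zero {i j : V} (h : T.adj i j = 1) : T.adj j i = 0 := by
  rcases eq_or_ne i j with rfl | hne
  · exact T.adj_self i
  · have := T.adj_add_adj_swap hne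
    omega

theorem ne_of_adj_eq_one {i j : V} (h : T.adj i j = 1) : i ≠ j := by
  rintro rfl
  simp [T.adj_self] at h

theorem ncard_outNbrs [Fintype V] (i : V) : (T.outNbrs i).ncard = ∑ j, T.adj i j := by
  classical
  simp only [adj]
  rw [← Finset.card_filter, ← Set.ncard_coe_finset]
  simp [outNbrs]

theorem ncard_outNbrs_inter [Fintype V] (i j : V) :
    (T.outNbrs i ∩ T.outNbrs j).ncard = ∑ w, T.adj i w * T.adj j w := by
  classical
  simp only [adj, ← ite_and, mul_ite, mul_one, mul_zero]
  rw [← Finset.card_filter, ← Set.ncard_coe_finset]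
  congr 1
  ext w
  simp [outNbrs, and_comm]

/-- A doubly regular tournament on `11` nodes has out-degrees `5`, and any two nodes have `2`
common out-neighbours. -/
theorem IsDoublyRegular.sum_adj {R : Tournament (Fin 11)} (hR : R.IsDoublyRegular) :
    (∀ i, ∑ j, R.adj i j = 5) ∧ ∀ i j, i ≠ j → ∑ w, R.adj i w * R.adj j w = 2 := by
  obtain ⟨hd, k, hk⟩ := hR
  simp only [ncard_outNbrs, ncard_outNbrs_inter] at hd hk
  have total (i) : ∑ j, R.adj i j + ∑ j, R.adj j i = 10 := by
    rw [← sum_add_distrib, ← add_sum_erase _ _ (mem_univ i),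
      sum_congr rfl fun j hj => R.adj_add_adj_swap (ne_of_mem_erase hj).symm]
    simp [R.adj_self]
  have deg (i) : ∑ j, R.adj i j = 5 := by
    have h1 : ∑ i, (∑ j, R.adj i j + ∑ j, R.adj j i) = 110 := by simp [total]
    rw [sum_add_distrib, sum_comm (f := fun i j => R.adj j i), sum_congr rfl fun j _ => hd j i] at h1
    simp only [sum_const, card_univ, Fintype.card_fin, smul_eq_mul] at h1
    omega
  refine ⟨deg, fun i j hij => (hk i j hij).trans ?_⟩
  -- Double count: each of the 11 nodes `w` is a common out-neighbour of `5 * 5` ordered pairs.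
  have h2 : ∑ i, ∑ j, ∑ w, R.adj i w * R.adj j w = 275 := by
    calc ∑ i, ∑ j, ∑ w, R.adj i w * R.adj j w
        = ∑ w, (∑ i, R.adj i w) * ∑ j, R.adj j w := by
          simp only [sum_mul_sum]
          exact (sum_congr rfl fun i _ => sum_comm).trans sum_comm
      _ = 275 := by
          have indeg (w) : ∑ i, R.adj i w = 5 := by
            have := total w
            have := deg w
            omega
          simp [indeg]
  have h3 (i) : ∑ j, ∑ w, R.adj i w * R.adj j w = 5 + 10 * k := by
    rw [← add_sum_erase _ _ (mem_univ i), sum_congr rfl fun j hj => hk i j (ne_of_mem_erase hj).symm]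
    have idem (w) : R.adj i w * R.adj i w = R.adj i w := by
      rcases Nat.le_one_iff_eq_zero_or_eq_one.mp (R.adj_le_one i w) with h | h <;> rw [h]
    simp [idem, deg]
  simp only [h3, sum_const, card_univ, Fintype.card_fin, smul_eq_mul] at h2
  omega

/-- In a tournament with `5` nodes and out-degrees `2` the nodes can be numbered cyclically such
that each node beats the two following ones. -/
theorem exists_cyclic_numbering {s : Finset V} (hs : s.card = 5)
    (hdeg : ∀ i ∈ s, ∑ j ∈ s, T.adj i j = 2) :
    ∃ a : Fin 5 → V, (∀ i, a i ∈ s) ∧ (∀ g : V → ℕ, ∑ j ∈ s, g j = ∑ i, g (a i)) ∧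
      ∀ i j, T.adj (a i) (a j) = if j = i + 1 ∨ j = i + 2 then 1 else 0 := by
  classical
  obtain ⟨c, hc⟩ : s.Nonempty := card_pos.mp (by omega)
  have beaten (i) (hi : i ∈ s) : (s.filter (T.beats i)).card = 2 := by
    rw [card_filter]
    exact hdeg i hi
  have pair (t : Finset V) (ht : t.card = 2) : ∃ p q, T.adj p q = 1 ∧ p ≠ q ∧ t = {p, q} := by
    obtain ⟨p, q, hpq, rfl⟩ := card_eq_two.mp ht
    rcases Nat.le_one_iff_eq_zero_or_eq_one.mp (T.adj_le_one p q) with h | h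
    · exact ⟨q, p, by have := T.adj_add_adj_swap hpq; omega, hpq.symm, pair_comm p q⟩
    · exact ⟨p, q, h, hpq, rfl⟩
  obtain ⟨p, q, hpq, hne, hout⟩ := pair _ (beaten c hc)
  have hp : p ∈ s ∧ T.beats c p := by simpa using hout.ge (mem_insert_self p {q})
  have hq : q ∈ s ∧ T.beats c q := by simpa using hout.ge (mem_insert_of_mem (mem_singleton_self q))
  have hcp := T.adj_eq_one_iff.mpr hp.2
  have hcq := T.adj_eq_one_iff.mpr hq.2
  have hcard : ({c, p, q} : Finset V).card = 3 :=
    card_eq_three.mpr ⟨c, p, q, T.ne_of_adj_eq_one hcp, T.ne_of_adj_eq_one hcq, hne, rfl⟩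
  have hsub : ({c, p, q} : Finset V) ⊆ s := by
    simp [insert_subset_iff, hc, hp.1, hq.1]
  obtain ⟨r, t, hrt, hne', hrest⟩ := pair (s \ {c, p, q}) (by
    rw [card_sdiff_of_subset hsub]
    omega)
  have hr : r ∈ s ∧ r ≠ c ∧ r ≠ p ∧ r ≠ q := by simpa using hrest.ge (mem_insert_self r {t})
  have ht : t ∈ s ∧ t ≠ c ∧ t ≠ p ∧ t ≠ q := by
    simpa using hrest.ge (mem_insert_of_mem (mem_singleton_self t))
  have hsum (g : V → ℕ) : ∑ j ∈ s, g j = g c + g p + g q + g r + g t := by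
    rw [← sum_sdiff hsub, hrest, sum_pair hne', sum_insert, sum_pair hne]
    · ring
    · simp [T.ne_of_adj_eq_one hcp, T.ne_of_adj_eq_one hcq]
  have dc := hdeg c hc
  have dp := hdeg p hp.1
  have dq := hdeg q hq.1
  have dr := hdeg r hr.1
  have dt := hdeg t ht.1
  rw [hsum] at dc dp dq dr dt
  have e1 := T.adj_add_adj_swap (T.ne_of_adj_eq_one hcp)
  have e2 := T.adj_add_adj_swap (T.ne_of_adj_eq_one hcq)
  have e3 := T.adj_add_adj_swap hr.2.1
  have e4 := T.adj_add_adj_swap hr.2.2.1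
  have e5 := T.adj_add_adj_swap hr.2.2.2
  have e6 := T.adj_add_adj_swap ht.2.1
  have e7 := T.adj_add_adj_swap ht.2.2.1
  have e8 := T.adj_add_adj_swap ht.2.2.2
  have e9 := T.adj_add_adj_swap hne
  have e10 := T.adj_add_adj_swap hne'
  simp only [T.adj_self] at dc dp dq dr dt
  refine ⟨![c, p, q, r, t], ?_, fun g => ?_, ?_⟩
  · intro i
    fin_cases i <;> simp [hc, hp.1, hq.1, hr.1, ht.1]
  · simp [hsum, Fin.sum_univ_five]
  -- The degrees force every edge: `r` and `t` beat `c`, so `q` beats `r` and `t`; `r` already beats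
  -- `c` and `t`, so `p` beats `r`, and `t` beats `p`.
  · intro i j
    fin_cases i <;> fin_cases j <;> simp [T.adj_self] <;> omega

end Tournament

/-! ### Structure of doubly regular tournaments on eleven nodes. -/

namespace Tournament

open Finset

/-- In a doubly regular tournament on `11` nodes, let `p` and `q` be two out-neighbours of `v`,
where `p` beats `q`. If no out-neighbour of `v` beats both, then some in-neighbour does. -/
theorem exists_adj_of_adj {R : Tournament (Fin 11)} (hR : R.IsDoublyRegular) {v p q : Fin 11}
    (hp : R.adj v p = 1) (hq : R.adj v q = 1) (hpq : R.adj p q = 1)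
    (hno : ∀ w, R.adj v w = 1 → R.adj w p = 1 → R.adj w q = 1 → False) :
    ∃ b, R.adj b v = 1 ∧ R.adj b p = 1 ∧ R.adj b q = 1 := by
  obtain ⟨hdeg, hcommon⟩ := hR.sum_adj
  -- `p` and `q` together beat `5 + 5 - 2 = 8` nodes; with `p` and `v` this covers at most 10 of the
  -- 11.
  obtain ⟨b, hb⟩ : ∃ b, R.adj p b + R.adj q b - R.adj p b * R.adj q b
      + (if b = p then 1 else 0) + (if b = v then 1 else 0) = 0 := by
    by_contra! h
    have h1 : ∑ b : Fin 11, 1 + ∑ b, R.adj p b * R.adj q b ≤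
        ∑ b, (R.adj p b + R.adj q b + (if b = p then 1 else 0) + (if b = v then 1 else 0)) := by
      rw [← sum_add_distrib]
      refine sum_le_sum fun b _ => ?_
      have h2 := h b
      have h3 : R.adj p b * R.adj q b ≤ R.adj p b := by
        simpa using Nat.mul_le_mul_left (R.adj p b) (R.adj_le_one q b)
      omega
    simp only [sum_add_distrib, hdeg, hcommon p q (R.ne_of_adj_eq_one hpq)] at h1
    simp at h1
  have hbp : b ≠ p := by
    rintro rfl
    simp at hb
  have hbv : b ≠ v := by
    rintro rfl
    simp at hb
  have hmul : R.adj p b * R.adj q b ≤ R.adj p b := by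
    simpa using Nat.mul_le_mul_left (R.adj p b) (R.adj_le_one q b)
  have hmul' : R.adj p b * R.adj q b ≤ R.adj q b := by
    simpa using Nat.mul_le_mul_right (R.adj q b) (R.adj_le_one p b)
  have hpb : R.adj p b = 0 := by
    rcases Nat.le_one_iff_eq_zero_or_eq_one.mp (R.adj_le_one p b) with h | h
    · exact h
    · rw [h] at hb
      omega
  have hqb : R.adj q b = 0 := by
    rw [hpb] at hb
    omega
  have hbq : b ≠ q := by
    rintro rfl
    omega
  have h1 := R.adj_add_adj_swap hbp
  have h2 := R.adj_add_adj_swap hbq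
  have h3 := R.adj_add_adj_swap hbv
  refine ⟨b, ?_, by omega, by omega⟩
  have := R.adj_le_one v b
  by_contra h
  exact hno b (by omega) (by omega) (by omega)

/-- A doubly regular tournament on `11` nodes consists of a node `v`, its out-neighbours `a i`,
which form a cyclic tournament, and its in-neighbours `b i`, where `b i` beats `a i` and
`a (i + 2)`. -/
theorem IsDoublyRegular.exists_numbering {R : Tournament (Fin 11)} (hR : R.IsDoublyRegular) :
    ∃ (v : Fin 11) (a b : Fin 5 → Fin 11),
      (∀ g : Fin 11 → ℕ, ∑ w, g w = g v + (∑ i, g (a i) + ∑ i, g (b i))) ∧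
      (∀ i, R.adj v (a i) = 1) ∧ (∀ i, R.adj (b i) v = 1) ∧
      (∀ i j, R.adj (a i) (a j) = if j = i + 1 ∨ j = i + 2 then 1 else 0) ∧
      (∀ i j, R.adj (b i) (a j) = if j = i ∨ j = i + 2 then 1 else 0) := by
  classical
  obtain ⟨hdeg, hcommon⟩ := hR.sum_adj
  let v : Fin 11 := 0
  let s : Finset (Fin 11) := univ.filter (R.beats v)
  have mem_s (i) : i ∈ s ↔ R.adj v i = 1 := by simp [s, adj_eq_one_iff]
  have sum_s (g : Fin 11 → ℕ) : ∑ j ∈ s, g j = ∑ j, R.adj v j * g j := by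
    simp [s, sum_filter, adj]
  have hs : s.card = 5 := by
    simpa using (sum_s fun _ => 1).trans (by simpa using hdeg v)
  obtain ⟨a, has, hsum, ha⟩ := R.exists_cyclic_numbering hs fun i hi => by
    rw [sum_s]
    exact hcommon v i (R.ne_of_adj_eq_one ((mem_s i).mp hi))
  have hva (i) : R.adj v (a i) = 1 := (mem_s _).mp (has i)
  have himage (w) (hw : R.adj v w = 1) : ∃ i, w = a i := by
    by_contra! h
    have := hsum fun j => if j = w then 1 else 0
    simp [(mem_s w).mpr hw, fun i => (h i).symm] at this
  have hb (i : Fin 5) : ∃ b, R.adj b v = 1 ∧ R.adj b (a i) = 1 ∧ R.adj b (a (i + 2)) = 1 := by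
    -- `a i` loses only to `a (i + 3)`, `a (i + 4)` among the `a`'s, and `a (i + 2)` only to `a i`,
    -- `a (i + 1)`.
    refine exists_adj_of_adj hR (hva i) (hva _) (by simp [ha]) fun w hw h1 h2 => ?_
    obtain ⟨k, rfl⟩ := himage w hw
    rw [ha] at h1 h2
    clear hw
    revert i k
    decide
  choose b hbv hb1 hb2 using hb
  have hba (i j) : R.adj (b i) (a j) = if j = i ∨ j = i + 2 then 1 else 0 := by
    -- The two known out-neighbours exhaust the common ones of `v` and `b i`.
    have h := hcommon v (b i) (R.ne_of_adj_eq_one (hbv i)).symm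
    rw [← sum_s, hsum, Fin.sum_univ_five] at h
    have h1 := hb1 i
    have h2 := hb2 i
    fin_cases i <;> fin_cases j <;> simp at h1 h2 h ⊢ <;> omega
  refine ⟨v, a, b, ?_, hva, hbv, ha, hba⟩
  let f : Option (Fin 5 ⊕ Fin 5) → Fin 11 := fun o => o.elim v (Sum.elim a b)
  -- The edges to `v` and the `a j` tell the eleven nodes apart.
  let code : Option (Fin 5 ⊕ Fin 5) → ℕ × (Fin 5 → ℕ) := fun o =>
    o.elim (0, fun _ => 1) (Sum.elim (fun i => (0, fun j => if j = i + 1 ∨ j = i + 2 then 1 else 0))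
      fun i => (1, fun j => if j = i ∨ j = i + 2 then 1 else 0))
  have hcode (o) : (R.adj (f o) v, fun j => R.adj (f o) (a j)) = code o := by
    rcases o with _ | i | i
    · simp [f, code, adj_self, hva]
    · simp [f, code, ha, R.adj_swap_eq_zero (hva i)]
    · simp [f, code, hba, hbv]
  have hinj : Function.Injective f := by
    intro o o' h
    have h1 : code o = code o' := by rw [← hcode, ← hcode, h]
    clear h
    revert o o'
    decide
  have hbij : Function.Bijective f :=
    (Fintype.bijective_iff_injective_and_card f).mpr ⟨hinj, by simp⟩
  intro g
  rw [← hbij.sum_comp g, Fintype.sum_option, Fintype.sum_sum_type]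
  rfl

theorem IsDoublyRegular.exists_nineNodes {R : Tournament (Fin 11)} (hR : R.IsDoublyRegular) :
    ∃ f : Fin 9 → Fin 11, ∀ i j, nineNodes i j = true → R.beats (f i) (f j) := by
  obtain ⟨hdeg, hcommon⟩ := hR.sum_adj
  obtain ⟨v, a, b, hsum, hva, hbv, ha, hba⟩ := hR.exists_numbering
  have hav (i) := R.adj_swap_eq_zero (hva i)
  have hab (i j) : R.adj (a j) (b i) = if j = i ∨ j = i + 2 then 0 else 1 := by
    have hne : b i ≠ a j := by
      intro h
      have := hbv i
      rw [h, hav] at this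
      omega
    have := R.adj_add_adj_swap hne
    rw [hba] at this
    split_ifs at this ⊢ <;> omega
  have hbb (i : Fin 5) : R.adj (b (i + 1)) (b i) = 1 := by
    have h0 := hdeg (b (i + 1))
    have h (j) := hcommon (b (i + 1)) (a j) (by
      intro h
      have := hbv (i + 1)
      rw [h, hav] at this
      omega)
    -- With the out-degree, these three counts are linear equations in the edges from `b (i + 1)` to
    -- the other `b`'s, and they force the edge to `b i`.
    have h1 := h (i + 1)
    have h2 := h (i + 2)
    have h3 := h (i + 4)
    have h4 := R.adj_self (b (i + 1))
    rw [hsum] at h0 h1 h2 h3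
    simp only [hbv, hav, hba, hab, ha, Fin.sum_univ_five] at h0 h1 h2 h3
    fin_cases i <;> simp at h0 h1 h2 h3 h4 ⊢ <;> omega
  refine ⟨![v, a 0, a 1, a 2, a 3, a 4, b 0, b 1, b 2], fun i j hij => R.adj_eq_one_iff.mp ?_⟩
  have h10 : R.adj (b 1) (b 0) = 1 := hbb 0
  have h21 : R.adj (b 2) (b 1) = 1 := hbb 1
  fin_cases i <;> fin_cases j <;> first
    | exact absurd hij (by decide)
    | exact hva _
    | exact hbv _
    | exact ha _ _
    | exact hba _ _
    | exact hab _ _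
    | exact h10
    | exact h21

end Tournament

theorem mainTheorem9 {V : Type*} (R : Tournament (Fin 11)) (hR : R.IsDoublyRegular)
    (T : Tournament V) (hT : T.IsCone R) :
    (rankTournamentClass 4).Forbids T := by
  rintro n _ ⟨M, hskew, hne, hrank, rfl⟩ S ⟨e⟩
  obtain ⟨g, hg⟩ : ∃ g : Fin 11 → V, ∀ i j, R.beats i j → T.beats (g i) (g j) := by
    obtain ⟨c, ⟨-, ⟨φ⟩⟩ | ⟨-, ⟨φ⟩⟩⟩ := hT <;>
      exact ⟨fun i => (φ.symm i).1, fun i j h => φ.symm.map_rel_iff.mpr h⟩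
  obtain ⟨f, hf⟩ := hR.exists_nineNodes
  exact not_nineNodes_of_rank_le_four hskew hrank.le (fun i => (e.symm (g (f i))).1)
    fun i j h => e.symm.map_rel_iff.mpr (hg _ _ (hf i j h))
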